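/- For a complex Banach space $X$ let $L(X)$ be the algebra of bounded linear operators on $X$ and $\sigma(\cdot)$ the spectrum. For $T\in L(X)$ write $(M,N)\in\mathrm{Red}(T)$ if $M,N$ are closed $T$-invariant subspaces with $X=M\oplus N$; $T_M$ denotes the restriction of $T$ to a $T$-invariant subspace $M$, and $T_{X/M}$ the operator induced by $T$ on $X/M$. $T$ is called almost invertible if there is $(M,N)\in\mathrm{Red}(T)$ such that $T_M$ is invertible in $L(M)$ and $\sigma(T_N)$ is at most countable; put $\sigma_{al}(T)=\{\lambda\in\mathbb C: T-\lambda I\text{ is not almost invertible}\}$. An operator is Browder if it is Fredholm with finite ascent and finite descent, $\sigma_b(R)=\{\lambda\in\mathbb{C}: R-\lambda I\text{ is not Browder}\}$, and $R\in L(X)$ is called Riesz if $\sigma_b(R)\subset\{0\}$. Let $X$ be a complex Banach space and $T\in L(X)$. Then: (i) $T$ is almost invertible if and only if its dual operator $T^*\in L(X^*)$, $T^*f=f\circ T$, is almost invertible. (ii) For every complex Banach space $Y$ and every $S\in L(Y)$, $T\oplus S\in L(X\oplus Y)$ is almost invertible if and only if both $T$ and $S$ are almost invertible. (iii) The following are equivalent: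 $T$ is almost invertible; $T^m$ is almost invertible for some integer $m\ge 1$; $T^m$ is almost invertible for every integer $m\ge 1$. (iv) If $M$ is a closed $T$-invariant subspace of $X$ such that both $T_M$ and $T_{X/M}$ are almost invertible, then $T$ is almost invertible. (v) If $R\in L(X)$ is a Riesz operator with $TR=RT$, then $\sigma_{al}(T+R)=\sigma_{al}(T)$. -/

import Mathlib

namespace AlmostInv

variable {X : Type*} [NormedAddCommGroup X] [NormedSpace ℂ X]

/-- `(M, N) ∈ Red(T)`: both `M` and `N` are closed `T`-invariant subspaces and `X = M ⊕ N`. -/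
structure Reduces (T : X →L[ℂ] X) (M N : Submodule ℂ X) : Prop where
  isClosed_left : IsClosed (M : Set X)
  isClosed_right : IsClosed (N : Set X)
  invariant_left : ∀ x ∈ M, T x ∈ M
  invariant_right : ∀ x ∈ N, T x ∈ N
  isCompl : IsCompl M N

/-- `T` is almost invertible: for some `(M, N) ∈ Red(T)` the restriction of `T` to `M` is
invertible and the restriction of `T` to `N` has at most countable spectrum. -/
def IsAlmostInvertible (T : X →L[ℂ] X) : Prop :=
  ∃ (M N : Submodule ℂ X) (h : Reduces T M N),
    IsUnit (T.restrict h.invariant_left : M →L[ℂ] M) ∧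
      (spectrum ℂ (T.restrict h.invariant_right : N →L[ℂ] N)).Countable

/-- The almost invertible spectrum `σ_al(T)`. -/
def almostSpectrum (T : X →L[ℂ] X) : Set ℂ :=
  {z | ¬ IsAlmostInvertible (T - z • (1 : X →L[ℂ] X))}

/-- A Browder operator: a Fredholm operator of finite ascent and finite descent. -/
structure IsBrowder (T : X →L[ℂ] X) : Prop where
  isFredholm : T.IsFredholm
  finite_ascent : ∃ n : ℕ, (T ^ n).ker = (T ^ (n + 1)).ker
  finite_descent : ∃ n : ℕ, (T ^ n).range = (T ^ (n + 1)).range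

/-- The Browder spectrum `σ_b(T)`. -/
def browderSpectrum (T : X →L[ℂ] X) : Set ℂ :=
  {z | ¬ IsBrowder (T - z • (1 : X →L[ℂ] X))}

/-- A Riesz operator: an operator whose Browder spectrum is contained in `{0}`. -/
def IsRiesz (R : X →L[ℂ] X) : Prop :=
  browderSpectrum R ⊆ {0}

/-- The dual operator `T* : X* → X*`, `T* f = f ∘ T`. -/
noncomputable def dualOp (T : X →L[ℂ] X) : StrongDual ℂ X →L[ℂ] StrongDual ℂ X :=
  ContinuousLinearMap.precomp ℂ T

/-- The operator `x + M ↦ T x + M` induced by `T` on `X ⧸ M`, for a `T`-invariant `M`. -/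
def quotientOp (T : X →L[ℂ] X) (M : Submodule ℂ X) (hM : ∀ x ∈ M, T x ∈ M) :
    (X ⧸ M) →L[ℂ] (X ⧸ M) :=
  M.liftQL (M.mkQL.comp T) fun x hx => by simpa using hM x hx

end AlmostInv

/-! Everything rests on `isAlmostInvertible_iff_countable`: `T` is almost invertible exactly when
its spectrum meets some disc around `0` in a countable set. If `T` splits as required, the
invertible summand contributes no spectrum near `0`. Conversely, a countable set misses some circle
`|z| = ρ` inside the disc, and the Riesz idempotent of that circle splits off the part of the
spectrum inside it.

The Riesz idempotent is built without contour integrals. After rescaling to the unit circle it is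
the limit of `(1 - S ^ (2 ^ j))⁻¹`, which averages resolvent values over the `2 ^ j`-th roots of
unity (`exists_idempotent_of_isUnit_one_sub_exp_smul`).

Claims (i)-(iv) then become facts about spectra: invariance under duality, unions for direct sums
and for invariant subspaces, and spectral mapping with finite fibres for powers. For (v), a Riesz
`R` has arbitrarily small spectral radius after removal of a finite-dimensional piece, so near each
point outside `σ(T)` only finitely many points of `σ(T + R)` occur. By the Lindelöf property `σ(T +
R) \ σ(T)` is countable; applying this to `-R` as well gives equality. -/

section BanachAlgebra

open Filter Topology

variable {A : Type*}

/-! ### Units and commuting perturbations in a Banach algebra. -/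

theorem IsIdempotentElem.isUnit_mul_add_smul [Ring A] [Algebra ℂ A] {Q U : A}
    (hQ : IsIdempotentElem Q) (hU : IsUnit U) (hUQ : Commute U Q) {c : ℂ} (hc : c ≠ 0) :
    IsUnit (U * Q + c • (1 - Q)) := by
  obtain ⟨u, rfl⟩ := hU
  have h1 : (↑u⁻¹ : A) * Q = Q * ↑u⁻¹ := hUQ.units_inv_left
  have h2 : (u : A) * Q = Q * u := hUQ
  have h3 : Q * Q = Q := hQ
  have h4 : Q * (1 - Q) = 0 := by rw [mul_sub, h3, mul_one, sub_self]
  have h5 : (1 - Q) * Q = 0 := by rw [sub_mul, h3, one_mul, sub_self]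
  have h6 : (1 - Q) * (1 - Q) = 1 - Q := by rw [mul_sub, h5, mul_one, sub_zero]
  refine isUnit_iff_exists.2 ⟨(↑u⁻¹ : A) * Q + c⁻¹ • (1 - Q), ?_, ?_⟩
  · have e1 : (u : A) * Q * (↑u⁻¹ * Q) = Q := by
      rw [h2, mul_assoc, u.mul_inv_cancel_left, h3]
    have e2 : (u : A) * Q * (1 - Q) = 0 := by rw [mul_assoc, h4, mul_zero]
    have e3 : (1 - Q) * (↑u⁻¹ * Q) = 0 := by rw [h1, ← mul_assoc, h5, zero_mul]
    simp only [add_mul, mul_add, smul_mul_assoc, mul_smul_comm, e1, e2, e3, h6, smul_smul,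
      inv_mul_cancel₀ hc, smul_zero, one_smul, add_zero, zero_add]
    abel
  · have e1 : (↑u⁻¹ : A) * Q * (u * Q) = Q := by
      rw [h1, mul_assoc, u.inv_mul_cancel_left, h3]
    have e2 : (↑u⁻¹ : A) * Q * (1 - Q) = 0 := by rw [mul_assoc, h4, mul_zero]
    have e3 : (1 - Q) * (u * Q) = 0 := by rw [h2, ← mul_assoc, h5, zero_mul]
    simp only [add_mul, mul_add, smul_mul_assoc, mul_smul_comm, e1, e2, e3, h6, smul_smul,
      mul_inv_cancel₀ hc, smul_zero, one_smul, add_zero, zero_add]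
    abel

theorem Commute.isUnit_of_isUnit_mul [Monoid A] {a b : A} (h : Commute a b) (hab : IsUnit (a * b)) :
    IsUnit a :=
  (h.isUnit_mul_iff.1 hab).1

theorem Commute.ringInverse_right [MonoidWithZero A] {a b : A} (h : Commute a b) :
    Commute a (Ring.inverse b) := by
  by_cases hb : IsUnit b
  · obtain ⟨u, rfl⟩ := hb
    rw [Ring.inverse_unit]
    exact h.units_inv_right
  · rw [Ring.inverse_non_unit _ hb]
    exact Commute.zero_right a

variable [NormedRing A]

/-- `1 - x` is a commuting factor of `1 - x ^ n`, which a Neumann series inverts. -/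
theorem isUnit_one_sub_of_norm_pow_lt_one [CompleteSpace A] {x : A} {n : ℕ} (h : ‖x ^ n‖ < 1) : IsUnit (1 - x) := by
  have h1 : IsUnit (1 - x ^ n) := (Units.oneSub _ h).isUnit
  rw [← mul_neg_geom_sum] at h1
  refine Commute.isUnit_of_isUnit_mul ?_ h1
  exact Commute.sum_right _ _ _ fun i _ =>
    ((Commute.one_left x).sub_left (Commute.refl x)).pow_right i

variable [NormedAlgebra ℂ A]

theorem exists_norm_pow_lt_of_spectralRadius_lt [CompleteSpace A] {b : A} {ε : ℝ} (hε : 0 < ε)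
    (h : ∀ z ∈ spectrum ℂ b, ‖z‖ < ε) : ∃ n : ℕ, n ≠ 0 ∧ ‖b ^ n‖ < ε ^ n := by
  lift ε to NNReal using hε.le
  have hr : spectralRadius ℂ b < ε := by
    rcases (spectrum ℂ b).eq_empty_or_nonempty with he | hne
    · simpa [spectralRadius, he] using hε
    · exact spectrum.spectralRadius_lt_of_forall_lt_of_nonempty hne fun z hz => h z hz
  have ht := (spectrum.pow_nnnorm_pow_one_div_tendsto_nhds_spectralRadius b).eventually
    (gt_mem_nhds hr)
  obtain ⟨n, hn, hn0⟩ := (ht.and (eventually_ne_atTop 0)).exists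
  refine ⟨n, hn0, ?_⟩
  have hn' : (0 : ℝ) < n := by positivity
  have := ENNReal.rpow_lt_rpow hn hn'
  rw [← ENNReal.rpow_mul, one_div_mul_cancel hn'.ne', ENNReal.rpow_one, ENNReal.rpow_natCast] at this
  exact_mod_cast this

/-- A unit perturbed by a commuting element of small spectral radius is a unit. -/
theorem Commute.isUnit_add_of_spectrum_small [CompleteSpace A] {u : Aˣ} {b : A} (h : Commute (u : A) b) {ε : ℝ}
    (hε : 0 < ε) (hu : ε * ‖(↑u⁻¹ : A)‖ ≤ 1) (hb : ∀ z ∈ spectrum ℂ b, ‖z‖ < ε) :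
    IsUnit ((u : A) + b) := by
  obtain ⟨n, hn, hbn⟩ := exists_norm_pow_lt_of_spectralRadius_lt hε hb
  have h2 : IsUnit (1 - (-(↑u⁻¹ * b))) := by
    refine isUnit_one_sub_of_norm_pow_lt_one (n := n) ?_
    rw [neg_pow, (show Commute (↑u⁻¹ : A) b from h.units_inv_left).mul_pow]
    calc ‖(-1) ^ n * ((↑u⁻¹ : A) ^ n * b ^ n)‖ = ‖(↑u⁻¹ : A) ^ n * b ^ n‖ := by
          rcases neg_one_pow_eq_or A n with h | h <;> simp [h]
      _ ≤ ‖(↑u⁻¹ : A)‖ ^ n * ‖b ^ n‖ :=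
          -- The norm of `1` is not assumed to be `1`, so the power bound needs `n ≠ 0`.
          (norm_mul_le _ _).trans (by gcongr; exact norm_pow_le' _ (Nat.pos_of_ne_zero hn))
      _ < 1 := by
          rcases (norm_nonneg (↑u⁻¹ : A)).eq_or_lt with h0 | h0
          · rw [← h0, zero_pow hn, zero_mul]; exact one_pos
          · calc ‖(↑u⁻¹ : A)‖ ^ n * ‖b ^ n‖ < ‖(↑u⁻¹ : A)‖ ^ n * ε ^ n :=
                mul_lt_mul_of_pos_left hbn (pow_pos h0 n)
              _ = (ε * ‖(↑u⁻¹ : A)‖) ^ n := by ring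
              _ ≤ 1 := pow_le_one₀ (by positivity) hu
  have h3 : (u : A) + b = u * (1 - (-(↑u⁻¹ * b))) := by
    rw [sub_neg_eq_add, mul_add, mul_one, u.mul_inv_cancel_left]
  rw [h3]
  exact u.isUnit.mul h2

/-! ### The Riesz idempotent of the unit disc by dyadic averaging. -/

/-- The element `(1 - e^{iθ} S^(2^j))⁻¹`. -/
noncomputable def dyadicResolvent (S : A) (j : ℕ) (θ : ℝ) : A :=
  Ring.inverse (1 - Complex.exp (Complex.I * θ) • S ^ (2 ^ j))

theorem exp_I_mul_add_pi (θ : ℝ) :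
    Complex.exp (Complex.I * ((θ + Real.pi : ℝ) : ℂ)) = -Complex.exp (Complex.I * θ) := by
  rw [Complex.ofReal_add, mul_add, Complex.exp_add, mul_comm Complex.I (Real.pi : ℂ),
    Complex.exp_pi_mul_I, mul_neg_one]

theorem one_sub_exp_smul_pow_succ (S : A) (j : ℕ) (θ : ℝ) :
    1 - Complex.exp (Complex.I * θ) • S ^ (2 ^ (j + 1)) =
      (1 - Complex.exp (Complex.I * (θ / 2 : ℝ)) • S ^ (2 ^ j)) *
        (1 - Complex.exp (Complex.I * (θ / 2 + Real.pi : ℝ)) • S ^ (2 ^ j)) := by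
  have h1 : Complex.exp (Complex.I * θ) =
      Complex.exp (Complex.I * (θ / 2 : ℝ)) * Complex.exp (Complex.I * (θ / 2 : ℝ)) := by
    rw [← Complex.exp_add]; congr 1; push_cast; ring
  rw [exp_I_mul_add_pi, h1, pow_succ 2 j, pow_mul, sq, neg_smul, sub_neg_eq_add, mul_add, mul_one,
    sub_mul, one_mul, smul_mul_smul_comm]
  abel

theorem isUnit_one_sub_exp_smul_pow {S : A}
    (hS : ∀ θ : ℝ, IsUnit (1 - Complex.exp (Complex.I * θ) • S)) (j : ℕ) (θ : ℝ) :
    IsUnit (1 - Complex.exp (Complex.I * θ) • S ^ (2 ^ j)) := by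
  induction j generalizing θ with
  | zero => simpa using hS θ
  | succ j ih =>
    rw [one_sub_exp_smul_pow_succ]
    exact (ih _).mul (ih _)

/-- This is `1/(1-a²) = ½(1/(1-a) + 1/(1+a))`; the two square roots of `e^{iθ}` sit at angles `θ/2`
and `θ/2 + π`. -/
theorem dyadicResolvent_succ {S : A}
    (hS : ∀ θ : ℝ, IsUnit (1 - Complex.exp (Complex.I * θ) • S)) (j : ℕ) (θ : ℝ) :
    dyadicResolvent S (j + 1) θ = (1 / 2 : ℂ) •
      (dyadicResolvent S j (θ / 2) + dyadicResolvent S j (θ / 2 + Real.pi)) := by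
  obtain ⟨u, hu⟩ := isUnit_one_sub_exp_smul_pow hS j (θ / 2)
  obtain ⟨v, hv⟩ := isUnit_one_sub_exp_smul_pow hS j (θ / 2 + Real.pi)
  have h2 : (u : A) + v = (2 : ℂ) • 1 := by
    rw [hu, hv, exp_I_mul_add_pi, neg_smul, two_smul]; abel
  unfold dyadicResolvent
  rw [one_sub_exp_smul_pow_succ, ← hu, ← hv, ← Units.val_mul, Ring.inverse_unit, Ring.inverse_unit,
    Ring.inverse_unit]
  have h3 : (↑v⁻¹ : A) * (u + v) * ↑u⁻¹ = ↑u⁻¹ + ↑v⁻¹ := by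
    rw [mul_add, add_mul, mul_assoc, u.mul_inv, v.inv_mul, mul_one, one_mul, add_comm]
  rw [← h3, h2, mul_inv_rev, Units.val_mul, mul_smul_comm, mul_one, smul_mul_assoc, smul_smul]
  norm_num

theorem norm_exp_I_mul_sub_le (θ φ : ℝ) :
    ‖Complex.exp (Complex.I * θ) - Complex.exp (Complex.I * φ)‖ ≤ |θ - φ| := by
  have h : Complex.exp (Complex.I * θ) - Complex.exp (Complex.I * φ) =
      Complex.exp (φ * Complex.I) * (Complex.exp (Complex.I * (θ - φ : ℝ)) - 1) := by
    rw [mul_sub, ← Complex.exp_add, mul_one, mul_comm (φ : ℂ)]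
    congr 2
    push_cast
    ring
  rw [h, norm_mul, Complex.norm_exp_ofReal_mul_I, one_mul]
  exact Real.norm_exp_I_mul_ofReal_sub_one_le

theorem exists_norm_dyadicResolvent_zero_le [CompleteSpace A] {S : A}
    (hS : ∀ θ : ℝ, IsUnit (1 - Complex.exp (Complex.I * θ) • S)) :
    ∃ C : ℝ, ∀ θ : ℝ, ‖dyadicResolvent S 0 θ‖ ≤ C := by
  have hc : ContinuousOn (fun z : ℂ => Ring.inverse (1 - z • S)) (Metric.sphere 0 1) := by
    intro z hz
    have hz1 : ‖z‖ = 1 := by simpa using hz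
    have hzu : IsUnit (1 - z • S) := by
      have := hS z.arg
      rwa [mul_comm, ← one_mul (Complex.exp _), ← Complex.ofReal_one, ← hz1,
        Complex.norm_mul_exp_arg_mul_I] at this
    obtain ⟨u, hu⟩ := hzu
    have h1 := NormedRing.inverse_continuousAt u
    rw [hu] at h1
    refine (ContinuousAt.comp (f := fun z : ℂ => 1 - z • S) h1 ?_).continuousWithinAt
    fun_prop
  obtain ⟨C, hC⟩ := (isCompact_sphere (0 : ℂ) 1).exists_bound_of_continuousOn hc
  refine ⟨C, fun θ => ?_⟩
  have := hC (Complex.exp (Complex.I * θ)) (by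
    rw [mem_sphere_zero_iff_norm, mul_comm, Complex.norm_exp_ofReal_mul_I])
  simpa [dyadicResolvent] using this

/-- The resolvent identity gives a Lipschitz bound at level `0`. Each averaging step halves the
angles, hence the constant; this decay makes the sequence at `θ = 0` Cauchy. -/
theorem exists_norm_dyadicResolvent_sub_le [CompleteSpace A] {S : A}
    (hS : ∀ θ : ℝ, IsUnit (1 - Complex.exp (Complex.I * θ) • S)) :
    ∃ L : ℝ, ∀ (j : ℕ) (θ φ : ℝ),
      ‖dyadicResolvent S j θ - dyadicResolvent S j φ‖ ≤ L / 2 ^ j * |θ - φ| := by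
  obtain ⟨C, hC⟩ := exists_norm_dyadicResolvent_zero_le hS
  have hC0 : 0 ≤ C := (norm_nonneg _).trans (hC 0)
  refine ⟨C * ‖S‖ * C, fun j => ?_⟩
  induction j with
  | zero =>
    intro θ φ
    obtain ⟨u, hu⟩ := hS θ
    obtain ⟨v, hv⟩ := hS φ
    have hθ : dyadicResolvent S 0 θ = ↑u⁻¹ := by
      rw [dyadicResolvent, pow_zero, pow_one, ← hu, Ring.inverse_unit]
    have hφ : dyadicResolvent S 0 φ = ↑v⁻¹ := by
      rw [dyadicResolvent, pow_zero, pow_one, ← hv, Ring.inverse_unit]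
    have h1 : (↑u⁻¹ : A) - ↑v⁻¹ = ↑u⁻¹ * (v - u) * ↑v⁻¹ := by
      rw [mul_sub, sub_mul, mul_assoc, v.mul_inv, u.inv_mul, mul_one, one_mul]
    have h2 : (v : A) - u = (Complex.exp (Complex.I * θ) - Complex.exp (Complex.I * φ)) • S := by
      rw [hu, hv, sub_smul]; abel
    have hCu := hC θ
    have hCv := hC φ
    rw [hθ] at hCu
    rw [hφ] at hCv
    rw [hθ, hφ, h1, h2, pow_zero, div_one]
    calc _ ≤ ‖(↑u⁻¹ : A)‖ * (‖Complex.exp (Complex.I * θ) - Complex.exp (Complex.I * φ)‖ * ‖S‖) *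
          ‖(↑v⁻¹ : A)‖ := by
            refine (norm_mul_le _ _).trans ?_
            gcongr
            refine (norm_mul_le _ _).trans ?_
            gcongr
            exact norm_smul_le _ _
      _ ≤ C * (|θ - φ| * ‖S‖) * C := by
            gcongr
            exact norm_exp_I_mul_sub_le θ φ
      _ = _ := by ring
  | succ j ih =>
    intro θ φ
    rw [dyadicResolvent_succ hS, dyadicResolvent_succ hS, ← smul_sub, add_sub_add_comm]
    have h1 := ih (θ / 2) (φ / 2)
    have h2 := ih (θ / 2 + Real.pi) (φ / 2 + Real.pi)
    have h3 : |θ / 2 - φ / 2| = |θ - φ| / 2 := by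
      rw [← sub_div, abs_div, abs_two]
    rw [add_sub_add_right_eq_sub] at h2
    rw [h3] at h1 h2
    refine (norm_smul_le _ _).trans ?_
    have h4 := norm_add_le (dyadicResolvent S j (θ / 2) - dyadicResolvent S j (φ / 2))
      (dyadicResolvent S j (θ / 2 + Real.pi) - dyadicResolvent S j (φ / 2 + Real.pi))
    have h5 : ‖(1 / 2 : ℂ)‖ = 1 / 2 := by norm_num
    rw [h5, pow_succ]
    calc _ ≤ 1 / 2 * (C * ‖S‖ * C / 2 ^ j * (|θ - φ| / 2) +
          C * ‖S‖ * C / 2 ^ j * (|θ - φ| / 2)) := by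
            gcongr; exact h4.trans (add_le_add h1 h2)
      _ = _ := by field_simp; ring

/-- The Riesz idempotent of the part of the spectrum of `S` inside the unit circle, obtained as the
limit of `(1 - S ^ (2 ^ j))⁻¹`. -/
theorem exists_tendsto_dyadicResolvent [CompleteSpace A] {S : A}
    (hS : ∀ θ : ℝ, IsUnit (1 - Complex.exp (Complex.I * θ) • S)) :
    ∃ P : A, IsIdempotentElem P ∧ Tendsto (fun j => dyadicResolvent S j 0) atTop (𝓝 P) := by
  obtain ⟨L, hL⟩ := exists_norm_dyadicResolvent_sub_le hS
  have hstep (j : ℕ) : dyadicResolvent S (j + 1) 0 - dyadicResolvent S j 0 =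
      (1 / 2 : ℂ) • (dyadicResolvent S j Real.pi - dyadicResolvent S j 0) := by
    rw [dyadicResolvent_succ hS, zero_div, zero_add, smul_add, smul_sub, add_sub_right_comm]
    nth_rw 2 [← one_smul ℂ (dyadicResolvent S j 0)]
    rw [← sub_smul, add_comm, sub_eq_add_neg _ ((1 / 2 : ℂ) • _), ← neg_smul]
    norm_num
  have hd (j : ℕ) : ‖dyadicResolvent S j Real.pi - dyadicResolvent S j 0‖ ≤
      L * Real.pi / 2 ^ j := by
    have := hL j Real.pi 0
    rwa [sub_zero, abs_of_pos Real.pi_pos, div_mul_eq_mul_div] at this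
  have hcauchy : CauchySeq fun j => dyadicResolvent S j 0 := by
    refine cauchySeq_of_le_geometric_two (C := L * Real.pi) fun j => ?_
    rw [dist_comm, dist_eq_norm, hstep]
    refine (norm_smul_le _ _).trans ?_
    have h5 : ‖(1 / 2 : ℂ)‖ = 1 / 2 := by norm_num
    have := hd j
    rw [h5, div_div, mul_comm 2, ← div_div]
    linarith
  obtain ⟨P, hP⟩ := cauchySeq_tendsto_of_complete hcauchy
  refine ⟨P, ?_, hP⟩
  have hd0 : Tendsto (fun j => dyadicResolvent S j Real.pi - dyadicResolvent S j 0) atTop (𝓝 0) := by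
    refine squeeze_zero_norm hd ?_
    have : Tendsto (fun j : ℕ => L * Real.pi * (1 / 2 : ℝ) ^ j) atTop (𝓝 (L * Real.pi * 0)) :=
      (tendsto_pow_atTop_nhds_zero_of_lt_one (by norm_num) (by norm_num)).const_mul _
    simpa [div_eq_mul_inv] using this
  -- The inverses `u`, `v` of the values at `0` and `π` satisfy `u + v = 2`, so the idempotency
  -- defect is controlled by their difference, which tends to `0`.
  have hsq (j : ℕ) : dyadicResolvent S j 0 * dyadicResolvent S j 0 - dyadicResolvent S j 0 =
      (-(1 / 2 : ℂ)) • ((dyadicResolvent S j Real.pi - dyadicResolvent S j 0) *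
        (dyadicResolvent S j 0 + dyadicResolvent S j 0 - 1)) := by
    obtain ⟨u, hu⟩ := isUnit_one_sub_exp_smul_pow hS j 0
    obtain ⟨v, hv⟩ := isUnit_one_sub_exp_smul_pow hS j Real.pi
    have h0 : dyadicResolvent S j 0 = ↑u⁻¹ := by
      rw [dyadicResolvent, ← hu, Ring.inverse_unit]
    have h1 : dyadicResolvent S j Real.pi = ↑v⁻¹ := by
      rw [dyadicResolvent, ← hv, Ring.inverse_unit]
    have h2 : (v : A) = 2 - u := by
      rw [hu, hv, ← zero_add Real.pi, exp_I_mul_add_pi]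
      simp only [Complex.ofReal_zero, mul_zero, Complex.exp_zero, one_smul, neg_smul]
      rw [← one_add_one_eq_two (R := A)]; abel
    rw [h0, h1]
    have huv : (v : A) * ↑u⁻¹ = ↑u⁻¹ + ↑u⁻¹ - 1 := by
      rw [h2, sub_mul, u.mul_inv, two_mul]
    rw [← huv, sub_mul, v.inv_mul_cancel_left, huv]
    have h3 : (↑u⁻¹ : A) - ↑u⁻¹ * (↑u⁻¹ + ↑u⁻¹ - 1) = (-2 : ℂ) • ((↑u⁻¹ : A) * ↑u⁻¹ - ↑u⁻¹) := by
      rw [neg_smul, two_smul]; noncomm_ring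
    rw [h3, smul_smul]
    norm_num
  have hlim := (hP.mul hP).sub hP
  simp_rw [hsq] at hlim
  have hlim' := (hd0.mul ((hP.add hP).sub_const 1)).const_smul (-(1 / 2 : ℂ))
  rw [zero_mul, smul_zero] at hlim'
  exact sub_eq_zero.1 (tendsto_nhds_unique hlim hlim')

/-- Spectral splitting along the unit circle. -/
theorem exists_idempotent_of_isUnit_one_sub_exp_smul [CompleteSpace A] {S : A}
    (hS : ∀ θ : ℝ, IsUnit (1 - Complex.exp (Complex.I * θ) • S)) :
    ∃ P : A, IsIdempotentElem P ∧ (∀ C, Commute C S → Commute C P) ∧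
      (∃ n, ‖(S * P) ^ n‖ < 1) ∧ IsUnit (S * (1 - P) + P) := by
  obtain ⟨P, hPP, hP⟩ := exists_tendsto_dyadicResolvent hS
  have hcomm : ∀ C, Commute C S → Commute C P := by
    intro C hC
    have h (j : ℕ) : C * dyadicResolvent S j 0 = dyadicResolvent S j 0 * C :=
      Commute.ringInverse_right ((Commute.one_right C).sub_right ((hC.pow_right _).smul_right _))
    have h1 := hP.const_mul C
    simp_rw [h] at h1
    exact tendsto_nhds_unique h1 (hP.mul_const C)
  have hPP' : P * P = P := hPP
  have hSP : S * P = P * S := hcomm S (Commute.refl S)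
  have hres (j : ℕ) : S ^ 2 ^ j * dyadicResolvent S j 0 = dyadicResolvent S j 0 - 1 ∧
      Commute (dyadicResolvent S j 0) (S ^ 2 ^ j) := by
    obtain ⟨u, hu⟩ := isUnit_one_sub_exp_smul_pow hS j 0
    have h0 : dyadicResolvent S j 0 = ↑u⁻¹ := by
      rw [dyadicResolvent, ← hu, Ring.inverse_unit]
    have h1 : S ^ 2 ^ j = 1 - u := by
      rw [hu]; simp
    rw [h0, h1]
    refine ⟨by rw [sub_mul, one_mul, u.mul_inv], ?_⟩
    exact (Commute.one_right _).sub_right (Commute.refl (u : A)).units_inv_left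
  have hxP (j : ℕ) : dyadicResolvent S j 0 * P = P * dyadicResolvent S j 0 :=
    hcomm _ (Commute.symm (Commute.ringInverse_right
      ((Commute.one_right S).sub_right (((Commute.refl S).pow_right _).smul_right _))))
  have haP (j : ℕ) : S ^ 2 ^ j * P = P * S ^ 2 ^ j := hcomm _ ((Commute.refl S).pow_left _)
  refine ⟨P, hPP, hcomm, ?_, ?_⟩
  · have h1 : Tendsto (fun j => (dyadicResolvent S j 0 - 1) * P) atTop (𝓝 0) := by
      have := (hP.sub_const 1).mul_const P
      rwa [sub_mul, hPP', one_mul, sub_self] at this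
    have h2 := h1.norm.eventually (gt_mem_nhds (show ‖(0 : A)‖ < 1 / 4 by simp))
    obtain ⟨j, hj⟩ := h2.exists
    refine ⟨2 ^ j, ?_⟩
    rw [(show Commute S P from hSP).mul_pow, hPP.pow_eq (by positivity)]
    -- With `t = ‖S ^ 2 ^ j * P‖`, the identity below gives `t ≤ ‖e‖ + t‖e‖`; the choice `‖e‖ < 1/4`
    -- forces `t ≤ 1/3`.
    set e := (dyadicResolvent S j 0 - 1) * P with he
    have h3 : S ^ 2 ^ j * P = e - S ^ 2 ^ j * P * e := by
      have : S ^ 2 ^ j * P * e = S ^ 2 ^ j * dyadicResolvent S j 0 * P - S ^ 2 ^ j * P := by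
        rw [he, mul_assoc, ← mul_assoc P, mul_sub, mul_one, ← hxP, sub_mul, mul_assoc, hPP',
          mul_sub, mul_assoc]
      rw [this, (hres j).1]
      abel
    have h4 : ‖S ^ 2 ^ j * P‖ ≤ ‖e‖ + ‖S ^ 2 ^ j * P‖ * ‖e‖ := by
      nth_rw 1 [h3]
      exact (norm_sub_le _ _).trans (by gcongr; exact norm_mul_le _ _)
    nlinarith [norm_nonneg (S ^ 2 ^ j * P), norm_nonneg e]
  · have h1 : Tendsto (fun j => (dyadicResolvent S j 0 - 1) * (1 - P) + P) atTop
        (𝓝 ((P - 1) * (1 - P) + P)) :=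
      ((hP.sub_const 1).mul_const (1 - P)).add_const P
    -- The limit is the involution `2P - 1`. Units form an open set, so some finite stage is already
    -- a unit.
    have h2 : IsUnit ((P - 1) * (1 - P) + P) := by
      have h3 : ((P - 1) * (1 - P) + P) * ((P - 1) * (1 - P) + P) = 1 := by
        have : (P - 1) * (1 - P) + P = P + P - 1 := by
          simp only [mul_sub, sub_mul, hPP', mul_one, one_mul]; abel
        rw [this]
        have : (P + P - 1) * (P + P - 1) = 4 • (P * P) - 4 • P + 1 := by noncomm_ring
        rw [this, hPP']; abel
      exact isUnit_iff_exists.2 ⟨_, h3, h3⟩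
    obtain ⟨j, hj⟩ := (h1.eventually (Units.isOpen.mem_nhds h2)).exists
    have hQ1 : (1 - P) * (1 - P) = 1 - P := hPP.one_sub
    have hQ2 : (1 - P) * P = 0 := by rw [sub_mul, hPP', one_mul, sub_self]
    have hQ3 : P * (1 - P) = 0 := by rw [mul_sub, hPP', mul_one, sub_self]
    have key {a b : A} (hb : b * P = P * b) :
        (a * (1 - P) + P) * (b * (1 - P) + P) = a * b * (1 - P) + P := by
      have hb' : (1 - P) * b = b * (1 - P) := by rw [sub_mul, mul_sub, hb, one_mul, mul_one]
      rw [add_mul, mul_add, mul_add, mul_assoc a, ← mul_assoc (1 - P) b, hb', mul_assoc b, hQ1,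
        mul_assoc a, hQ2, ← mul_assoc P b, ← hb, mul_assoc b, hQ3, hPP', mul_assoc]
      simp
    -- On the range of `1 - P`, this says `S ^ 2 ^ j` times its resolvent is invertible; commuting
    -- factors then give `S ^ 2 ^ j`, and finally `S`.
    have h4 : IsUnit ((S ^ 2 ^ j * (1 - P) + P) * (dyadicResolvent S j 0 * (1 - P) + P)) := by
      rw [key (hxP j), (hres j).1]
      exact hj
    have h5 : IsUnit (S ^ 2 ^ j * (1 - P) + P) := by
      refine Commute.isUnit_of_isUnit_mul ?_ h4
      rw [Commute, SemiconjBy, key (hxP j), key (haP j), (hres j).2.eq]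
    have hpow : S ^ (2 ^ j - 1) * P = P * S ^ (2 ^ j - 1) := hcomm _ ((Commute.refl S).pow_left _)
    have h6 : S ^ 2 ^ j = S * S ^ (2 ^ j - 1) := by
      rw [← pow_succ', Nat.sub_add_cancel Nat.one_le_two_pow]
    have h7 : S ^ 2 ^ j = S ^ (2 ^ j - 1) * S := by
      rw [← pow_succ, Nat.sub_add_cancel Nat.one_le_two_pow]
    have h8 : (S * (1 - P) + P) * (S ^ (2 ^ j - 1) * (1 - P) + P) = S ^ 2 ^ j * (1 - P) + P := by
      rw [key hpow, ← h6]
    refine Commute.isUnit_of_isUnit_mul (b := S ^ (2 ^ j - 1) * (1 - P) + P) ?_ (h8 ▸ h5)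
    rw [Commute, SemiconjBy, key hpow, key hSP, ← h6, ← h7]

end BanachAlgebra

/-! ### Invertibility of restrictions, quotients, sums and duals. -/

section Operators

variable {X : Type*} [NormedAddCommGroup X] [NormedSpace ℂ X]

theorem ContinuousLinearMap.isUnit_restrict_of_eqOn {T : X →L[ℂ] X} {N : Submodule ℂ X}
    (hT : ∀ x ∈ N, T x ∈ N) (U : (X →L[ℂ] X)ˣ) (hU : ∀ x ∈ N, (↑U⁻¹ : X →L[ℂ] X) x ∈ N)
    (hTU : ∀ x ∈ N, T x = (U : X →L[ℂ] X) x) : IsUnit (T.restrict hT : N →L[ℂ] N) := by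
  have h1 (x : X) : (U : X →L[ℂ] X) ((↑U⁻¹ : X →L[ℂ] X) x) = x := by
    rw [← mul_apply_eq_comp, U.mul_inv, one_apply_eq_self]
  have h2 (x : X) : (↑U⁻¹ : X →L[ℂ] X) ((U : X →L[ℂ] X) x) = x := by
    rw [← mul_apply_eq_comp, U.inv_mul, one_apply_eq_self]
  refine isUnit_iff_exists.2 ⟨(↑U⁻¹ : X →L[ℂ] X).restrict hU, ?_, ?_⟩
  · ext x
    change T ((↑U⁻¹ : X →L[ℂ] X) x) = x
    rw [hTU _ (hU x x.2), h1]
  · ext x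
    change (↑U⁻¹ : X →L[ℂ] X) (T x) = x
    rw [hTU _ x.2, h2]

/-- An operator agreeing on the range of `P` with a unit that commutes with `P`
restricts to a unit there. -/
theorem ContinuousLinearMap.isUnit_restrict_range {T U P : X →L[ℂ] X}
    (hT : ∀ x ∈ P.range, T x ∈ P.range) (hU : IsUnit U) (hUP : Commute U P)
    (hTU : T * P = U * P) : IsUnit (T.restrict hT : P.range →L[ℂ] P.range) := by
  obtain ⟨u, rfl⟩ := hU
  refine ContinuousLinearMap.isUnit_restrict_of_eqOn hT u ?_ ?_
  · rintro _ ⟨x, rfl⟩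
    exact ⟨(↑u⁻¹ : X →L[ℂ] X) x, (DFunLike.congr_fun hUP.units_inv_left.eq x).symm⟩
  · rintro _ ⟨x, rfl⟩
    exact DFunLike.congr_fun hTU x

theorem ContinuousLinearMap.range_one_sub {P : X →L[ℂ] X} (hP : IsIdempotentElem P) :
    (1 - P).range = P.ker := by
  have hP' (x : X) : P (P x) = P x := DFunLike.congr_fun hP.eq x
  ext x
  constructor
  · rintro ⟨y, rfl⟩
    change P (y - P y) = 0
    rw [map_sub, hP', sub_self]
  · intro hx
    refine ⟨x, ?_⟩
    change x - P x = x
    rw [show P x = 0 from hx, sub_zero]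

theorem ContinuousLinearMap.isUnit_restrict_ker {T U P : X →L[ℂ] X} (hP : IsIdempotentElem P)
    (hT : ∀ x ∈ P.ker, T x ∈ P.ker) (hU : IsUnit U) (hUP : Commute U P)
    (hTU : T * (1 - P) = U * (1 - P)) : IsUnit (T.restrict hT : P.ker →L[ℂ] P.ker) := by
  obtain ⟨u, rfl⟩ := hU
  have hr := ContinuousLinearMap.range_one_sub hP
  refine ContinuousLinearMap.isUnit_restrict_of_eqOn hT u ?_ ?_
  · intro x hx
    change P ((↑u⁻¹ : X →L[ℂ] X) x) = 0
    refine (DFunLike.congr_fun hUP.units_inv_left.eq x).symm.trans ?_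
    change (↑u⁻¹ : X →L[ℂ] X) (P x) = 0
    rw [show P x = 0 from hx, map_zero]
  · intro x hx
    rw [← hr] at hx
    obtain ⟨y, rfl⟩ := hx
    exact DFunLike.congr_fun hTU y

theorem AlmostInv.Reduces.of_commute {T P : X →L[ℂ] X} (hP : IsIdempotentElem P)
    (hTP : Commute T P) : AlmostInv.Reduces T P.ker P.range := by
  have hTP' (x : X) : T (P x) = P (T x) := DFunLike.congr_fun hTP.eq x
  have htc := ContinuousLinearMap.IsIdempotentElem.isTopCompl hP
  refine ⟨P.isClosed_ker, ?_, ?_, ?_, htc.isCompl.symm⟩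
  · exact htc.isClosed
  · intro x hx
    change P (T x) = 0
    rw [← hTP', show P x = 0 from hx, map_zero]
  · rintro _ ⟨x, rfl⟩
    exact ⟨T x, (hTP' x).symm⟩

variable [CompleteSpace X]

theorem AlmostInv.Reduces.isUnit {T : X →L[ℂ] X} {M N : Submodule ℂ X}
    (h : AlmostInv.Reduces T M N)
    (hM : IsUnit (T.restrict h.invariant_left : M →L[ℂ] M))
    (hN : IsUnit (T.restrict h.invariant_right : N →L[ℂ] N)) : IsUnit T := by
  have := h.isClosed_left.completeSpace_coe
  have := h.isClosed_right.completeSpace_coe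
  rw [ContinuousLinearMap.isUnit_iff_bijective] at hM hN ⊢
  constructor
  · rw [injective_iff_map_eq_zero]
    intro x hx
    obtain ⟨m, hm, n, hn, rfl⟩ := Submodule.mem_sup.1
      (h.isCompl.sup_eq_top ▸ Submodule.mem_top : x ∈ M ⊔ N)
    rw [map_add] at hx
    have h1 : T m = 0 := by
      refine Submodule.disjoint_def.1 h.isCompl.disjoint _ (h.invariant_left m hm) ?_
      rw [eq_neg_of_add_eq_zero_left hx]
      exact N.neg_mem (h.invariant_right n hn)
    rw [h1, zero_add] at hx
    have hm0 : (⟨m, hm⟩ : M) = 0 := (injective_iff_map_eq_zero _).1 hM.1 _ (Subtype.ext h1)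
    have hn0 : (⟨n, hn⟩ : N) = 0 := (injective_iff_map_eq_zero _).1 hN.1 _ (Subtype.ext hx)
    rw [show m = 0 from congrArg Subtype.val hm0, show n = 0 from congrArg Subtype.val hn0, add_zero]
  · intro x
    obtain ⟨m, hm, n, hn, rfl⟩ := Submodule.mem_sup.1
      (h.isCompl.sup_eq_top ▸ Submodule.mem_top : x ∈ M ⊔ N)
    obtain ⟨m', hm'⟩ := hM.2 ⟨m, hm⟩
    obtain ⟨n', hn'⟩ := hN.2 ⟨n, hn⟩
    exact ⟨m' + n', by
      rw [map_add]
      exact congrArg₂ (· + ·) (congrArg Subtype.val hm') (congrArg Subtype.val hn')⟩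

theorem isUnit_of_isUnit_restrict_of_isUnit_quotient {T : X →L[ℂ] X} (M : Submodule ℂ X)
    [hMc : IsClosed (M : Set X)] (hM : ∀ x ∈ M, T x ∈ M)
    (h1 : IsUnit (T.restrict hM : M →L[ℂ] M)) (h2 : IsUnit (AlmostInv.quotientOp T M hM)) :
    IsUnit T := by
  have := hMc.completeSpace_coe
  rw [ContinuousLinearMap.isUnit_iff_bijective] at h1 h2 ⊢
  have hq (x : X) : AlmostInv.quotientOp T M hM (Submodule.Quotient.mk x) =
    Submodule.Quotient.mk (T x) := rfl
  constructor
  · rw [injective_iff_map_eq_zero]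
    intro x hx
    have hxM : x ∈ M := by
      rw [← Submodule.Quotient.mk_eq_zero]
      refine (injective_iff_map_eq_zero _).1 h2.1 _ ?_
      rw [hq, hx, Submodule.Quotient.mk_zero]
    have : (⟨x, hxM⟩ : M) = 0 := (injective_iff_map_eq_zero _).1 h1.1 _ (Subtype.ext hx)
    exact congrArg Subtype.val this
  · intro y
    obtain ⟨z, hz⟩ := h2.2 (Submodule.Quotient.mk y)
    obtain ⟨x, rfl⟩ := Submodule.Quotient.mk_surjective M z
    rw [hq, Submodule.Quotient.eq] at hz
    obtain ⟨m, hm⟩ := h1.2 ⟨T x - y, hz⟩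
    refine ⟨x - m, ?_⟩
    have hm' : T m = T x - y := congrArg Subtype.val hm
    rw [map_sub, hm', sub_sub_cancel]

theorem isUnit_prodMap_iff {Y : Type*} [NormedAddCommGroup Y] [NormedSpace ℂ Y] [CompleteSpace Y]
    (T : X →L[ℂ] X) (S : Y →L[ℂ] Y) : IsUnit (T.prodMap S) ↔ IsUnit T ∧ IsUnit S := by
  simp only [ContinuousLinearMap.isUnit_iff_bijective]
  rw [ContinuousLinearMap.coe_prodMap', Prod.map_bijective]

/-- If the dual is invertible, norming functionals show that `T` is bounded below, so its range is
closed. A functional vanishing on the range is killed by the dual, hence zero, and the range is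
everything. -/
theorem isUnit_dualOp_iff (T : X →L[ℂ] X) : IsUnit (AlmostInv.dualOp T) ↔ IsUnit T := by
  constructor
  · rintro ⟨u, hu⟩
    have hu' (f : StrongDual ℂ X) : ((u : StrongDual ℂ X →L[ℂ] StrongDual ℂ X) f) = f.comp T := by
      rw [hu]; rfl
    have hinv (f : StrongDual ℂ X) : ((↑u⁻¹ : StrongDual ℂ X →L[ℂ] StrongDual ℂ X) f).comp T = f := by
      rw [← hu', ← mul_apply_eq_comp, u.mul_inv, one_apply_eq_self]
    set C := ‖(↑u⁻¹ : StrongDual ℂ X →L[ℂ] StrongDual ℂ X)‖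
    have hanti : AntilipschitzWith ‖(↑u⁻¹ : StrongDual ℂ X →L[ℂ] StrongDual ℂ X)‖₊ T := by
      refine ContinuousLinearMap.antilipschitz_of_bound T fun x => ?_
      obtain ⟨f, hf, hfx⟩ := exists_dual_vector'' ℂ x
      have h1 : ((↑u⁻¹ : StrongDual ℂ X →L[ℂ] StrongDual ℂ X) f) (T x) = f x :=
        DFunLike.congr_fun (hinv f) x
      calc ‖x‖ = ‖f x‖ := by rw [hfx]; simp
        _ = ‖((↑u⁻¹ : StrongDual ℂ X →L[ℂ] StrongDual ℂ X) f) (T x)‖ := by rw [h1]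
        _ ≤ ‖(↑u⁻¹ : StrongDual ℂ X →L[ℂ] StrongDual ℂ X) f‖ * ‖T x‖ :=
            ContinuousLinearMap.le_opNorm _ _
        _ ≤ C * ‖T x‖ := by
            gcongr
            calc _ ≤ C * ‖f‖ := ContinuousLinearMap.le_opNorm _ _
              _ ≤ C * 1 := by gcongr
              _ = C := mul_one _
    have hclosed : IsClosed (T.range : Set X) := hanti.isClosed_range T.uniformContinuous
    rw [ContinuousLinearMap.isUnit_iff_bijective]
    refine ⟨hanti.injective, ?_⟩
    by_contra hsurj
    have : ∃ x, x ∉ T.range := by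
      simpa [Function.Surjective] using hsurj
    obtain ⟨x, hx⟩ := this
    obtain ⟨g, hg⟩ := SeparatingDual.exists_ne_zero (R := ℂ)
      (x := (Submodule.Quotient.mk x : X ⧸ T.range)) (by rwa [Ne, Submodule.Quotient.mk_eq_zero])
    have hgT : (g.comp T.range.mkQL).comp T = 0 := by
      ext y
      change g (Submodule.Quotient.mk (T y)) = 0
      have hy : (Submodule.Quotient.mk (T y) : X ⧸ T.range) = 0 :=
        (Submodule.Quotient.mk_eq_zero T.range).2 ⟨y, rfl⟩
      rw [hy, map_zero]
    have hg0 : g.comp T.range.mkQL = 0 := by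
      rw [← one_apply_eq_self (F := StrongDual ℂ X →L[ℂ] StrongDual ℂ X) (g.comp T.range.mkQL), ← u.inv_mul,
        mul_apply_eq_comp, hu', hgT, map_zero]
    exact hg (DFunLike.congr_fun hg0 x)
  · rintro ⟨u, rfl⟩
    refine isUnit_iff_exists.2 ⟨AlmostInv.dualOp (↑u⁻¹ : X →L[ℂ] X), ?_, ?_⟩
    · ext f x
      change f ((↑u⁻¹ * ↑u : X →L[ℂ] X) x) = f x
      rw [u.inv_mul]; rfl
    · ext f x
      change f ((↑u * ↑u⁻¹ : X →L[ℂ] X) x) = f x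
      rw [u.mul_inv]; rfl

end Operators

/-! ### The spectral criterion, and claims (i)-(iv). -/

section Characterization

open AlmostInv Filter Topology

variable {X : Type*} [NormedAddCommGroup X] [NormedSpace ℂ X]

theorem algebraMap_sub_restrict {T : X →L[ℂ] X} {M : Submodule ℂ X} (h : ∀ x ∈ M, T x ∈ M) (z : ℂ)
    (h' : ∀ x ∈ M, (algebraMap ℂ (X →L[ℂ] X) z - T) x ∈ M) :
    algebraMap ℂ (M →L[ℂ] M) z - T.restrict h = (algebraMap ℂ (X →L[ℂ] X) z - T).restrict h' := by
  ext x
  rfl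

theorem algebraMap_sub_mem {T : X →L[ℂ] X} {M : Submodule ℂ X} (h : ∀ x ∈ M, T x ∈ M) (z : ℂ)
    (x : X) (hx : x ∈ M) : (algebraMap ℂ (X →L[ℂ] X) z - T) x ∈ M :=
  M.sub_mem (M.smul_mem z hx) (h x hx)

theorem AlmostInv.Reduces.algebraMap_sub {T : X →L[ℂ] X} {M N : Submodule ℂ X}
    (h : Reduces T M N) (z : ℂ) : Reduces (algebraMap ℂ (X →L[ℂ] X) z - T) M N :=
  ⟨h.isClosed_left, h.isClosed_right, algebraMap_sub_mem h.invariant_left z,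
    algebraMap_sub_mem h.invariant_right z, h.isCompl⟩

variable [CompleteSpace X]

theorem AlmostInv.Reduces.spectrum_subset {T : X →L[ℂ] X} {M N : Submodule ℂ X}
    (h : Reduces T M N) :
    spectrum ℂ T ⊆ spectrum ℂ (T.restrict h.invariant_left : M →L[ℂ] M) ∪
      spectrum ℂ (T.restrict h.invariant_right : N →L[ℂ] N) := by
  intro z hz
  by_contra hcon
  rw [Set.mem_union, not_or, spectrum.notMem_iff, spectrum.notMem_iff,
    algebraMap_sub_restrict _ z (h.algebraMap_sub z).invariant_left,
    algebraMap_sub_restrict _ z (h.algebraMap_sub z).invariant_right] at hcon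
  exact hz ((h.algebraMap_sub z).isUnit hcon.1 hcon.2)

theorem exists_ball_disjoint_spectrum {A : Type*} [NormedRing A] [NormedAlgebra ℂ A]
    [CompleteSpace A] {a : A} (ha : IsUnit a) :
    ∃ r > 0, ∀ z ∈ spectrum ℂ a, r ≤ ‖z‖ := by
  have h0 : (0 : ℂ) ∈ resolventSet ℂ a := by
    rw [spectrum.mem_resolventSet_iff, map_zero, zero_sub]
    exact ha.neg
  obtain ⟨r, hr, hb⟩ := Metric.isOpen_iff.1 (spectrum.isOpen_resolventSet a) 0 h0
  refine ⟨r, hr, fun z hz => not_lt.1 fun hlt => hz (hb ?_)⟩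
  rwa [mem_ball_zero_iff]

theorem isAlmostInvertible_of_countable {T : X →L[ℂ] X} {r : ℝ} (hr : 0 < r)
    (hc : (spectrum ℂ T ∩ Metric.ball 0 r).Countable) : IsAlmostInvertible T := by
  -- Otherwise the moduli of a countable set would fill an interval.
  obtain ⟨ρ, hρ, hρs⟩ : ∃ ρ ∈ Set.Ioo 0 r, ∀ z ∈ spectrum ℂ T, ‖z‖ ≠ ρ := by
    by_contra! hcon
    have hIoo : (Set.Ioo 0 r).Countable := by
      refine (hc.image norm).mono fun ρ hρ => ?_
      obtain ⟨z, hz, hzρ⟩ := hcon ρ hρ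
      exact ⟨z, ⟨hz, by rw [mem_ball_zero_iff, hzρ]; exact hρ.2⟩, hzρ⟩
    rw [← Cardinal.le_aleph0_iff_set_countable, Cardinal.mk_Ioo_real hr] at hIoo
    exact absurd hIoo (not_le.2 Cardinal.aleph0_lt_continuum)
  have hρ0 : (ρ : ℂ) ≠ 0 := by exact_mod_cast hρ.1.ne'
  have hunit {z : ℂ} (hz : z ∉ spectrum ℂ T) : IsUnit (z • (1 : X →L[ℂ] X) - T) := by
    rw [← Algebra.algebraMap_eq_smul_one]
    exact spectrum.notMem_iff.1 hz
  set S : X →L[ℂ] X := (ρ : ℂ)⁻¹ • T with hSdef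
  have hTS : T = (ρ : ℂ) • S := by rw [hSdef, smul_smul, mul_inv_cancel₀ hρ0, one_smul]
  have hS (θ : ℝ) : IsUnit (1 - Complex.exp (Complex.I * θ) • S) := by
    set w := Complex.exp (Complex.I * θ)
    have hw : ‖w‖ = 1 := by simp only [w, mul_comm Complex.I]; exact Complex.norm_exp_ofReal_mul_I θ
    have hw0 : w ≠ 0 := Complex.exp_ne_zero _
    have h1 : IsUnit ((ρ * w⁻¹) • (1 : X →L[ℂ] X) - T) := by
      refine hunit fun hmem => hρs _ hmem ?_
      rw [norm_mul, norm_inv, hw, inv_one, mul_one, Complex.norm_real, Real.norm_of_nonneg hρ.1.le]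
    have h2 : (1 : X →L[ℂ] X) - w • S = (w * (ρ : ℂ)⁻¹) • ((ρ * w⁻¹) • (1 : X →L[ℂ] X) - T) := by
      have : w * (ρ : ℂ)⁻¹ * (ρ * w⁻¹) = 1 := by field_simp
      rw [hSdef, smul_sub, smul_smul, smul_smul, this, one_smul]
    rw [h2]
    exact (h1.smul (Units.mk0 (w * (ρ : ℂ)⁻¹) (mul_ne_zero hw0 (inv_ne_zero hρ0))))
  obtain ⟨P, hP, hcomm, ⟨n, hn⟩, hPu⟩ := exists_idempotent_of_isUnit_one_sub_exp_smul hS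
  have hTP : Commute T P := hcomm T (by rw [hSdef]; exact (Commute.refl T).smul_right _)
  have hSP : Commute S P := hcomm S (Commute.refl S)
  have hPP : P * P = P := hP
  have hQP : (1 - P) * P = 0 := by rw [sub_mul, one_mul, hPP, sub_self]
  have hPQ : P * (1 - P) = 0 := by rw [mul_sub, mul_one, hPP, sub_self]
  have hQQ : (1 - P) * (1 - P) = 1 - P := hP.one_sub
  have hred := Reduces.of_commute hP hTP
  refine ⟨P.ker, P.range, hred, ?_, ?_⟩
  -- The kernel of `P` carries the spectrum outside the circle, where `T = ρS` is invertible.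
  · refine ContinuousLinearMap.isUnit_restrict_ker hP hred.invariant_left
      (U := (ρ : ℂ) • (S * (1 - P) + P)) (hPu.smul (Units.mk0 (ρ : ℂ) hρ0)) ?_ ?_
    · exact ((hSP.mul_left ((Commute.one_left P).sub_left (Commute.refl P))).add_left
        (Commute.refl P)).smul_left _
    · rw [smul_mul_assoc, add_mul, mul_assoc, hQQ, hPQ, add_zero, hTS, smul_mul_assoc]
  · refine hc.mono fun z hz => ?_
    have hmem := algebraMap_sub_mem hred.invariant_right z
    have hcT : Commute (z • (1 : X →L[ℂ] X) - T) P :=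
      ((Commute.one_left P).smul_left z).sub_left hTP
    constructor
    · by_contra hzT
      refine spectrum.notMem_iff.2 ?_ hz
      rw [algebraMap_sub_restrict _ z hmem]
      refine ContinuousLinearMap.isUnit_restrict_range hmem (hunit hzT) hcT ?_
      rw [Algebra.algebraMap_eq_smul_one]
    · rw [mem_ball_zero_iff]
      by_contra hzr
      have hzρ : ρ ≤ ‖z‖ := hρ.2.le.trans (not_lt.1 hzr)
      have hz0 : z ≠ 0 := norm_pos_iff.1 (hρ.1.trans_le hzρ)
      refine spectrum.notMem_iff.2 ?_ hz
      rw [algebraMap_sub_restrict _ z hmem]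
      -- On the range of `P` a power of `S` is a strict contraction, so no `z` with `‖z‖ ≥ ρ` is
      -- spectral.
      have h1 : IsUnit (1 - (ρ * z⁻¹) • (S * P)) := by
        refine isUnit_one_sub_of_norm_pow_lt_one (n := n) ?_
        rw [smul_pow]
        refine (norm_smul_le ((ρ * z⁻¹ : ℂ) ^ n) ((S * P) ^ n)).trans_lt (lt_of_le_of_lt ?_ hn)
        refine mul_le_of_le_one_left (norm_nonneg _) ?_
        rw [norm_pow, norm_mul, norm_inv, Complex.norm_real, Real.norm_of_nonneg hρ.1.le]
        exact pow_le_one₀ (mul_nonneg hρ.1.le (inv_nonneg.2 (norm_nonneg z))) (mul_inv_le_one_of_le₀ hzρ (norm_nonneg z))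
      refine ContinuousLinearMap.isUnit_restrict_range hmem
        (U := z • (1 - (ρ * z⁻¹) • (S * P))) (h1.smul (Units.mk0 z hz0)) ?_ ?_
      · exact ((Commute.one_left P).sub_left
          ((hSP.mul_left (Commute.refl P)).smul_left _)).smul_left z
      · rw [Algebra.algebraMap_eq_smul_one, smul_sub, smul_smul, sub_mul, sub_mul, smul_mul_assoc,
          smul_mul_assoc, mul_assoc S, hPP, hTS, smul_mul_assoc]
        congr 2
        field_simp

theorem isAlmostInvertible_iff_countable {T : X →L[ℂ] X} :
    IsAlmostInvertible T ↔ ∃ r > 0, (spectrum ℂ T ∩ Metric.ball 0 r).Countable := by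
  refine ⟨?_, fun ⟨r, hr, hc⟩ => isAlmostInvertible_of_countable hr hc⟩
  rintro ⟨M, N, h, hM, hN⟩
  have := h.isClosed_left.completeSpace_coe
  obtain ⟨r, hr, hb⟩ := exists_ball_disjoint_spectrum (A := M →L[ℂ] M) hM
  refine ⟨r, hr, hN.mono ?_⟩
  rintro z ⟨hz, hzr⟩
  refine (h.spectrum_subset hz).resolve_left fun hzM => ?_
  exact absurd (hb z hzM) (not_le.2 (mem_ball_zero_iff.1 hzr))

theorem isAlmostInvertible_dualOp_iff (T : X →L[ℂ] X) :
    IsAlmostInvertible (dualOp T) ↔ IsAlmostInvertible T := by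
  have h : spectrum ℂ (dualOp T) = spectrum ℂ T := by
    ext z
    have h : dualOp (z • (1 : X →L[ℂ] X) - T) =
        z • (1 : StrongDual ℂ X →L[ℂ] StrongDual ℂ X) - dualOp T := by
      ext f x
      change f (z • x - T x) = z • f x - f (T x)
      rw [map_sub, map_smul, smul_eq_mul]
    rw [spectrum.mem_iff, spectrum.mem_iff, Algebra.algebraMap_eq_smul_one,
      Algebra.algebraMap_eq_smul_one, ← isUnit_dualOp_iff (z • (1 : X →L[ℂ] X) - T), h]
  rw [isAlmostInvertible_iff_countable, isAlmostInvertible_iff_countable, h]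

theorem spectrum_prodMap {Y : Type*} [NormedAddCommGroup Y] [NormedSpace ℂ Y] [CompleteSpace Y]
    (T : X →L[ℂ] X) (S : Y →L[ℂ] Y) :
    spectrum ℂ (T.prodMap S) = spectrum ℂ T ∪ spectrum ℂ S := by
  ext z
  have h : algebraMap ℂ (X × Y →L[ℂ] X × Y) z - T.prodMap S =
      (algebraMap ℂ (X →L[ℂ] X) z - T).prodMap (algebraMap ℂ (Y →L[ℂ] Y) z - S) := by
    ext p <;> rfl
  rw [Set.mem_union, spectrum.mem_iff, spectrum.mem_iff, spectrum.mem_iff, h, isUnit_prodMap_iff,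
    not_and_or]

theorem isAlmostInvertible_prodMap_iff {Y : Type*} [NormedAddCommGroup Y] [NormedSpace ℂ Y]
    [CompleteSpace Y] (T : X →L[ℂ] X) (S : Y →L[ℂ] Y) :
    IsAlmostInvertible (T.prodMap S) ↔ IsAlmostInvertible T ∧ IsAlmostInvertible S := by
  simp only [isAlmostInvertible_iff_countable, spectrum_prodMap]
  constructor
  · rintro ⟨r, hr, hc⟩
    exact ⟨⟨r, hr, hc.mono (by gcongr; exact Set.subset_union_left)⟩,
      ⟨r, hr, hc.mono (by gcongr; exact Set.subset_union_right)⟩⟩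
  · rintro ⟨⟨r, hr, hc⟩, ⟨s, hs, hd⟩⟩
    refine ⟨min r s, lt_min hr hs, (hc.union hd).mono ?_⟩
    rintro z ⟨hz | hz, hzb⟩
    · exact Or.inl ⟨hz, Metric.ball_subset_ball (min_le_left _ _) hzb⟩
    · exact Or.inr ⟨hz, Metric.ball_subset_ball (min_le_right _ _) hzb⟩

theorem isAlmostInvertible_pow_iff (T : X →L[ℂ] X) {m : ℕ} (hm : 1 ≤ m) :
    IsAlmostInvertible (T ^ m) ↔ IsAlmostInvertible T := by
  have hm0 : m ≠ 0 := by omega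
  simp only [isAlmostInvertible_iff_countable]
  constructor
  · rintro ⟨r, hr, hc⟩
    -- Radius at most `1` ensures `‖z‖ ^ m ≤ ‖z‖`, so `z ^ m` stays in the ball of radius `r`.
    refine ⟨min r 1, lt_min hr one_pos, ?_⟩
    have hpre : ((fun z : ℂ => z ^ m) ⁻¹' (spectrum ℂ (T ^ m) ∩ Metric.ball 0 r)).Countable := by
      rw [← Set.biUnion_preimage_singleton]
      refine hc.biUnion fun w _ => Set.Finite.countable ?_
      refine (Polynomial.nthRoots m w).toFinset.finite_toSet.subset fun z hz => ?_
      simpa [Polynomial.mem_nthRoots (Nat.pos_of_ne_zero hm0)] using hz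
    refine hpre.mono ?_
    rintro z ⟨hz, hzb⟩
    rw [mem_ball_zero_iff, lt_min_iff] at hzb
    refine ⟨spectrum.pow_mem_pow T m hz, ?_⟩
    rw [mem_ball_zero_iff, norm_pow]
    exact (pow_le_of_le_one (norm_nonneg z) hzb.2.le hm0).trans_lt hzb.1
  · rintro ⟨r, hr, hc⟩
    refine ⟨r ^ m, pow_pos hr m, (hc.image (· ^ m)).mono ?_⟩
    rintro w ⟨hw, hwb⟩
    rw [spectrum.map_pow_of_pos T (by omega)] at hw
    obtain ⟨z, hz, rfl⟩ := hw
    refine ⟨z, ⟨hz, ?_⟩, rfl⟩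
    rw [mem_ball_zero_iff, norm_pow] at hwb
    rw [mem_ball_zero_iff]
    exact lt_of_pow_lt_pow_left₀ m hr.le hwb

theorem isAlmostInvertible_of_restrict_of_quotient {T : X →L[ℂ] X} (M : Submodule ℂ X)
    [IsClosed (M : Set X)] (hM : ∀ x ∈ M, T x ∈ M)
    (h1 : IsAlmostInvertible (T.restrict hM : M →L[ℂ] M))
    (h2 : IsAlmostInvertible (quotientOp T M hM)) : IsAlmostInvertible T := by
  have := (inferInstance : IsClosed (M : Set X)).completeSpace_coe
  have hs : spectrum ℂ T ⊆ spectrum ℂ (T.restrict hM : M →L[ℂ] M) ∪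
      spectrum ℂ (quotientOp T M hM) := by
    intro z hz
    by_contra hcon
    have hz' := algebraMap_sub_mem hM z
    have hq : algebraMap ℂ (X ⧸ M →L[ℂ] X ⧸ M) z - quotientOp T M hM =
        quotientOp (algebraMap ℂ (X →L[ℂ] X) z - T) M hz' := by
      ext y
      obtain ⟨x, rfl⟩ := Submodule.Quotient.mk_surjective M y
      rfl
    rw [Set.mem_union, not_or, spectrum.notMem_iff, spectrum.notMem_iff,
      algebraMap_sub_restrict _ z hz', hq] at hcon
    exact hz (isUnit_of_isUnit_restrict_of_isUnit_quotient M hz' hcon.1 hcon.2)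
  rw [isAlmostInvertible_iff_countable] at h1 h2 ⊢
  obtain ⟨r, hr, hc⟩ := h1
  obtain ⟨s, hs', hd⟩ := h2
  refine ⟨min r s, lt_min hr hs', (hc.union hd).mono ?_⟩
  rintro z ⟨hz, hzb⟩
  rcases hs hz with hz | hz
  · exact Or.inl ⟨hz, Metric.ball_subset_ball (min_le_left _ _) hzb⟩
  · exact Or.inr ⟨hz, Metric.ball_subset_ball (min_le_right _ _) hzb⟩

end Characterization

/-! ### Commuting Riesz perturbations, claim (v). -/

section Riesz

open AlmostInv Filter Topology

variable {X : Type*} [NormedAddCommGroup X] [NormedSpace ℂ X]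

theorem ContinuousLinearMap.finiteDimensional_ker_mul {f g : X →L[ℂ] X}
    (hf : FiniteDimensional ℂ f.ker) (hg : FiniteDimensional ℂ g.ker) :
    FiniteDimensional ℂ (f * g).ker := by
  refine Module.Finite.iff_fg.2 (Submodule.fg_of_fg_map_of_fg_inf_ker g.toLinearMap ?_ ?_)
  · have hle : (f * g).ker.map g.toLinearMap ≤ f.ker := by
      rintro _ ⟨x, hx, rfl⟩
      exact hx
    exact Module.Finite.iff_fg.1 (Submodule.finiteDimensional_of_le hle)
  · exact Module.Finite.iff_fg.1
      (Submodule.finiteDimensional_of_le (inf_le_right : (f * g).ker ⊓ g.ker ≤ g.ker))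

theorem ContinuousLinearMap.finiteDimensional_ker_pow {f : X →L[ℂ] X}
    (hf : FiniteDimensional ℂ f.ker) (n : ℕ) : FiniteDimensional ℂ (f ^ n).ker := by
  induction n with
  | zero =>
    rw [pow_zero]
    have : ((1 : X →L[ℂ] X).ker) = ⊥ := LinearMap.ker_id
    rw [this]
    infer_instance
  | succ n ih => rw [pow_succ]; exact ContinuousLinearMap.finiteDimensional_ker_mul ih hf

theorem AlmostInv.IsBrowder.exists_pow {A : X →L[ℂ] X} (hA : IsBrowder A) :
    ∃ p : ℕ, p ≠ 0 ∧ (∀ x, (A ^ p) ((A ^ p) x) = 0 → (A ^ p) x = 0) ∧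
      ∀ x, ∃ y, (A ^ p) x = (A ^ p) ((A ^ p) y) := by
  obtain ⟨n, hn⟩ := hA.finite_ascent
  obtain ⟨m, hm⟩ := hA.finite_descent
  have hadd (i j : ℕ) (x : X) : (A ^ (i + j)) x = (A ^ i) ((A ^ j) x) := by
    rw [pow_add]; rfl
  have hker (k : ℕ) (x : X) (hx : (A ^ (n + k)) x = 0) : (A ^ n) x = 0 := by
    induction k generalizing x with
    | zero => exact hx
    | succ k ih =>
      have h1 : (A ^ n) ((A ^ 1) x) = 0 := ih _ (by rw [← hadd]; exact hx)
      have h2 : x ∈ (A ^ (n + 1)).ker := by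
        change (A ^ (n + 1)) x = 0
        rw [hadd, h1]
      rwa [← hn] at h2
  have hrange (k : ℕ) (x : X) : ∃ y, (A ^ m) x = (A ^ (m + k)) y := by
    induction k with
    | zero => exact ⟨x, rfl⟩
    | succ k ih =>
      obtain ⟨y, hy⟩ := ih
      have h2 : (A ^ m) y ∈ (A ^ (m + 1)).range := hm ▸ ⟨y, rfl⟩
      obtain ⟨w, hw⟩ := h2
      refine ⟨w, ?_⟩
      have hw' : (A ^ (m + 1)) w = (A ^ m) y := hw
      rw [hy, add_comm m k, hadd, ← hw', ← hadd]
      congr 2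
      ring
  -- Past both ascent and descent; the extra `1` makes `p` nonzero, so that `A ^ (p - 1)` can serve
  -- in inverting `A`.
  refine ⟨n + m + 1, by omega, fun x hx => ?_, fun x => ?_⟩
  · rw [← hadd, show n + m + 1 + (n + m + 1) = n + (n + m + m + 2) by ring] at hx
    rw [show n + m + 1 = (m + 1) + n by ring, hadd, hker _ x hx, map_zero]
  · obtain ⟨y, hy⟩ := hrange (n + m + 1 + n + 1) ((A ^ (n + 1)) x)
    refine ⟨y, ?_⟩
    rw [← hadd, show n + m + 1 = m + (n + 1) by ring, hadd, hy]
    congr 2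
    ring

/-- The finite-codimensional idempotent splitting off the nilpotent part of a Browder operator. -/
theorem AlmostInv.IsBrowder.exists_idempotent [CompleteSpace X] {A : X →L[ℂ] X}
    (hA : IsBrowder A) :
    ∃ Q : X →L[ℂ] X, IsIdempotentElem Q ∧ (∀ C, Commute C A → Commute C Q) ∧
      FiniteDimensional ℂ Q.ker ∧ IsUnit (A * Q + (1 - Q)) := by
  obtain ⟨p, hp0, hpk, hpr⟩ := hA.exists_pow
  have hKfin : FiniteDimensional ℂ (A ^ p).ker :=
    ContinuousLinearMap.finiteDimensional_ker_pow hA.isFredholm.finite_ker p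
  have hcompl : IsCompl (A ^ p).range (A ^ p).ker := by
    constructor
    · rw [Submodule.disjoint_def]
      rintro _ ⟨x, rfl⟩ hx
      exact hpk x hx
    · rw [codisjoint_iff, Submodule.eq_top_iff']
      intro x
      obtain ⟨y, hy⟩ := hpr x
      refine Submodule.mem_sup.2 ⟨(A ^ p) y, ⟨y, rfl⟩, x - (A ^ p) y, ?_, by abel⟩
      change (A ^ p) (x - (A ^ p) y) = 0
      rw [map_sub, hy, sub_self]
  have hKclosed : IsClosed ((A ^ p).ker : Set X) := (A ^ p).isClosed_ker
  -- Restricted to a closed complement of its finite-dimensional kernel, `A ^ p` is injective with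
  -- the same range, and that range has a closed algebraic complement.
  have hRclosed : IsClosed ((A ^ p).range : Set X) := by
    obtain ⟨C, hC, hKC⟩ := (Submodule.ClosedComplemented.of_finiteDimensional
      (A ^ p).ker).exists_isClosed_isCompl
    have := hC.completeSpace_coe
    have hr : ((A ^ p).comp C.subtypeL).range = (A ^ p).range := by
      apply le_antisymm
      · rintro _ ⟨x, rfl⟩
        exact ⟨x, rfl⟩
      · rintro _ ⟨x, rfl⟩
        obtain ⟨k, hk, c, hc, rfl⟩ := Submodule.mem_sup.1
          (hKC.sup_eq_top ▸ Submodule.mem_top : x ∈ (A ^ p).ker ⊔ C)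
        refine ⟨⟨c, hc⟩, ?_⟩
        change (A ^ p) c = (A ^ p) (k + c)
        rw [map_add, show (A ^ p) k = 0 from hk, zero_add]
    rw [← hr]
    refine ContinuousLinearMap.closed_complemented_range_of_isCompl_of_ker_eq_bot _ (A ^ p).ker
      (hr ▸ hcompl) hKclosed ?_
    rw [eq_bot_iff]
    intro x hx
    exact Subtype.ext (Submodule.disjoint_def.1 hKC.disjoint _ hx x.2)
  have htop := Submodule.IsCompl.isTopCompl_of_isClosed hcompl hRclosed hKclosed
  set Q := Submodule.projectionL _ _ htop with hQ
  have hQidem : IsIdempotentElem Q := Submodule.isIdempotentElem_projectionL htop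
  have hQker : Q.ker = (A ^ p).ker := Submodule.ker_projectionL htop
  have hQl {x : X} (hx : x ∈ (A ^ p).range) : Q x = x := Submodule.projectionL_apply_left htop ⟨x, hx⟩
  have hQr {x : X} (hx : x ∈ (A ^ p).ker) : Q x = 0 := Submodule.projectionL_apply_right htop ⟨x, hx⟩
  have hQmem (x : X) : Q x ∈ (A ^ p).range := Submodule.projectionL_apply_mem htop x
  have hsubmem (x : X) : x - Q x ∈ (A ^ p).ker := by
    rw [← hQker]
    change Q (x - Q x) = 0
    rw [map_sub, hQl (hQmem x), sub_self]
  have hcomm (C : X →L[ℂ] X) (hC : Commute C A) : Commute C Q := by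
    have hCp (x : X) : C ((A ^ p) x) = (A ^ p) (C x) := DFunLike.congr_fun (hC.pow_right p).eq x
    ext x
    change C (Q x) = Q (C x)
    have h1 : C x = C (Q x) + C (x - Q x) := by rw [← map_add]; congr 1; abel
    have h2 : C (Q x) ∈ (A ^ p).range := by
      obtain ⟨y, hy⟩ := hQmem x
      exact ⟨C y, by rw [← hy]; exact (hCp y).symm⟩
    have h3 : C (x - Q x) ∈ (A ^ p).ker := by
      change (A ^ p) (C (x - Q x)) = 0
      rw [← hCp, show (A ^ p) (x - Q x) = 0 from hsubmem x, map_zero]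
    rw [h1, map_add, hQl h2, hQr h3, add_zero]
  refine ⟨Q, hQidem, hcomm, hQker ▸ hKfin, ?_⟩
  have hAQ (x : X) : A (Q x) = Q (A x) := DFunLike.congr_fun (hcomm A (Commute.refl A)).eq x
  have hpA (x : X) : (A ^ p) x = (A ^ (p - 1)) (A x) := by
    nth_rw 1 [← Nat.sub_add_cancel (Nat.one_le_iff_ne_zero.2 hp0)]
    rw [pow_succ]; rfl
  have hpA' (x : X) : (A ^ p) x = A ((A ^ (p - 1)) x) := by
    nth_rw 1 [← Nat.sub_add_cancel (Nat.one_le_iff_ne_zero.2 hp0)]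
    rw [pow_succ']; rfl
  have hpp (x : X) : (A ^ (p - 1)) ((A ^ p) x) = (A ^ p) ((A ^ (p - 1)) x) :=
    DFunLike.congr_fun ((Commute.refl A).pow_pow (p - 1) p).eq x
  rw [ContinuousLinearMap.isUnit_iff_bijective]
  constructor
  · rw [injective_iff_map_eq_zero]
    intro x hx
    have hx' : A (Q x) + (x - Q x) = 0 := hx
    have h1 : A (Q x) = 0 := by
      have h2 := congrArg Q hx'
      rwa [map_add, hQr (hsubmem x), add_zero, map_zero, ← hAQ, hQl (hQmem x)] at h2
    have h3 : Q x = 0 := by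
      refine Submodule.disjoint_def.1 hcompl.disjoint _ (hQmem x) ?_
      change (A ^ p) (Q x) = 0
      rw [hpA, h1, map_zero]
    rwa [h1, h3, zero_add, sub_zero] at hx'
  · intro y
    obtain ⟨w, hw⟩ := hQmem y
    obtain ⟨v, hv⟩ := hpr w
    have hw' : (A ^ p) w = Q y := hw
    -- Since `Q y = A ^ (2p) v`, dropping one factor of `A` gives a preimage inside the range of `A
    -- ^ p`; on `Q.ker` the operator is the identity.
    refine ⟨(A ^ p) ((A ^ (p - 1)) v) + (y - Q y), ?_⟩
    have h1 : Q ((A ^ p) ((A ^ (p - 1)) v) + (y - Q y)) = (A ^ p) ((A ^ (p - 1)) v) := by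
      rw [map_add, hQr (hsubmem y), add_zero]
      exact hQl ⟨_, rfl⟩
    set x := (A ^ p) ((A ^ (p - 1)) v) + (y - Q y) with hx
    change A (Q x) + (x - Q x) = y
    have h2 : A ((A ^ p) ((A ^ (p - 1)) v)) = Q y := by rw [← hpp, ← hpA', ← hv, hw']
    rw [h1, h2, hx]
    abel

theorem IsIdempotentElem.isUnit_mul_sub_smul {A : Type*} [Ring A] [Algebra ℂ A] {a Q : A} {z : ℂ}
    (hQ : IsIdempotentElem Q) (haQ : Commute a Q) (hz : z ≠ 0) (ha : IsUnit (a - z • 1)) :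
    IsUnit (a * Q - z • 1) := by
  have h := hQ.isUnit_mul_add_smul ha
    (haQ.sub_left ((Commute.one_left Q).smul_left z)) (neg_ne_zero.2 hz)
  convert h using 1
  rw [sub_mul, smul_mul_assoc, one_mul, neg_smul, smul_sub]
  abel

/-- `R` can be made to have arbitrarily small spectral radius by cutting it down with a
finite-codimensional idempotent commuting with everything that commutes with `R`. -/
def HasFiniteCodimCuts (R : X →L[ℂ] X) : Prop :=
  ∀ ε > 0, ∃ Q : X →L[ℂ] X, IsIdempotentElem Q ∧ (∀ C, Commute C R → Commute C Q) ∧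
    FiniteDimensional ℂ Q.ker ∧ ∀ z ∈ spectrum ℂ (R * Q), ‖z‖ < ε

theorem HasFiniteCodimCuts.neg {R : X →L[ℂ] X} (hR : HasFiniteCodimCuts R) :
    HasFiniteCodimCuts (-R) := by
  intro ε hε
  obtain ⟨Q, hQ, hcomm, hfin, hσ⟩ := hR ε hε
  refine ⟨Q, hQ, fun C hC => hcomm C (by simpa using hC.neg_right), hfin, fun z hz => ?_⟩
  rw [neg_mul, ← spectrum.neg_eq, Set.mem_neg] at hz
  rw [← norm_neg]
  exact hσ _ hz

theorem AlmostInv.IsRiesz.hasFiniteCodimCuts [CompleteSpace X] {R : X →L[ℂ] X} (hR : IsRiesz R) :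
    HasFiniteCodimCuts R := by
  intro ε hε
  have hbrowder {z : ℂ} (hz : z ≠ 0) : IsBrowder (R - z • (1 : X →L[ℂ] X)) := by
    by_contra hcon
    exact hz (hR hcon)
  have hcompact : IsCompact (spectrum ℂ R ∩ {z | ε ≤ ‖z‖}) :=
    (spectrum.isCompact R).inter_right (isClosed_le continuous_const continuous_norm)
  -- Each point of the compact set has a neighbourhood served by one idempotent, and products of
  -- commuting idempotents serve finite unions. The clause `z ≠ 0` is needed because these
  -- neighbourhoods may contain `0`, where `R * Q` can fail to be invertible.
  have key : ∃ Q : X →L[ℂ] X, IsIdempotentElem Q ∧ (∀ C, Commute C R → Commute C Q) ∧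
      FiniteDimensional ℂ Q.ker ∧
      ∀ z ∈ spectrum ℂ R ∩ {z | ε ≤ ‖z‖}, z ≠ 0 → IsUnit (R * Q - z • (1 : X →L[ℂ] X)) := by
    refine hcompact.induction_on (p := fun s => ∃ Q : X →L[ℂ] X, IsIdempotentElem Q ∧
      (∀ C, Commute C R → Commute C Q) ∧ FiniteDimensional ℂ Q.ker ∧
      ∀ z ∈ s, z ≠ 0 → IsUnit (R * Q - z • (1 : X →L[ℂ] X))) ?_ ?_ ?_ ?_
    · refine ⟨1, IsIdempotentElem.one, fun C _ => Commute.one_right C, ?_, by simp⟩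
      rw [show (1 : X →L[ℂ] X).ker = ⊥ from LinearMap.ker_id]
      infer_instance
    · rintro s t hst ⟨Q, h1, h2, h3, h4⟩
      exact ⟨Q, h1, h2, h3, fun z hz => h4 z (hst hz)⟩
    · rintro s t ⟨Q, h1, h2, h3, h4⟩ ⟨Q', h1', h2', h3', h4'⟩
      have hRQ : Commute R Q := h2 R (Commute.refl R)
      have hRQ' : Commute R Q' := h2' R (Commute.refl R)
      have hQQ' : Commute Q Q' := h2' Q hRQ.symm
      refine ⟨Q * Q', h1.mul_of_commute hQQ' h1', fun C hC => (h2 C hC).mul_right (h2' C hC),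
        ContinuousLinearMap.finiteDimensional_ker_mul h3 h3', ?_⟩
      rintro z (hz | hz) hz0
      · rw [← mul_assoc]
        exact h1'.isUnit_mul_sub_smul (hRQ'.mul_left hQQ') hz0 (h4 z hz hz0)
      · rw [hQQ'.eq, ← mul_assoc]
        exact h1.isUnit_mul_sub_smul (hRQ.mul_left hQQ'.symm) hz0 (h4' z hz hz0)
    · rintro z₀ ⟨-, hz₀⟩
      have hz₀0 : z₀ ≠ 0 := norm_pos_iff.1 (hε.trans_le hz₀)
      obtain ⟨Q, h1, h2, h3, h4⟩ := (hbrowder hz₀0).exists_idempotent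
      have h2' (C : X →L[ℂ] X) (hC : Commute C R) : Commute C Q :=
        h2 C (hC.sub_right ((Commute.one_right C).smul_right z₀))
      have hRQ : Commute R Q := h2' R (Commute.refl R)
      have hQQ : Q * Q = Q := h1
      have hcont : Continuous fun z : ℂ => (R - z • (1 : X →L[ℂ] X)) * Q + (1 - Q) := by fun_prop
      have hnhds := hcont.continuousAt.preimage_mem_nhds (Units.isOpen.mem_nhds h4)
      refine ⟨_, mem_nhdsWithin_of_mem_nhds hnhds, Q, h1, h2', h3, fun z hz hz0 => ?_⟩
      have hz' : IsUnit ((R - z • (1 : X →L[ℂ] X)) * Q + (1 - Q)) := hz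
      have h := h1.isUnit_mul_add_smul hz' (((hRQ.sub_left
        ((Commute.one_left Q).smul_left z)).mul_left (Commute.refl Q)).add_left
        ((Commute.one_left Q).sub_left (Commute.refl Q))) (neg_ne_zero.2 hz0)
      convert h using 1
      rw [add_mul, mul_assoc, hQQ, sub_mul 1 Q Q, one_mul, hQQ, sub_self, add_zero, sub_mul,
        smul_mul_assoc, one_mul, neg_smul, smul_sub]
      abel
  obtain ⟨Q, h1, h2, h3, h4⟩ := key
  refine ⟨Q, h1, h2, h3, fun z hz => not_le.1 fun hzε => ?_⟩
  have hz0 : z ≠ 0 := norm_pos_iff.1 (hε.trans_le hzε)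
  refine spectrum.notMem_iff.2 ?_ hz
  rw [IsUnit.sub_iff, Algebra.algebraMap_eq_smul_one]
  by_cases hzR : z ∈ spectrum ℂ R
  · exact h4 z ⟨hzR, hzε⟩ hz0
  · refine h1.isUnit_mul_sub_smul (h2 R (Commute.refl R)) hz0 ?_
    rw [IsUnit.sub_iff, ← Algebra.algebraMap_eq_smul_one]
    exact spectrum.notMem_iff.1 hzR

/-- Split along `Q`. On its range `T + R - z` agrees with `T - z + R * Q`, a small commuting
perturbation of a unit at `z = μ` and hence invertible nearby; on its finite-dimensional kernel the
spectrum is finite. -/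
theorem HasFiniteCodimCuts.exists_nhds_finite_spectrum_add [CompleteSpace X] {T R : X →L[ℂ] X}
    (hR : HasFiniteCodimCuts R) (hTR : Commute T R) {μ : ℂ} (hμ : μ ∉ spectrum ℂ T) :
    ∃ V ∈ 𝓝 μ, (V ∩ spectrum ℂ (T + R)).Finite := by
  have hu : IsUnit (T - μ • (1 : X →L[ℂ] X)) := by
    rw [IsUnit.sub_iff, ← Algebra.algebraMap_eq_smul_one]
    exact spectrum.notMem_iff.1 hμ
  obtain ⟨u, hu⟩ := hu
  obtain ⟨Q, hQ, hcomm, hfin, hσ⟩ := hR (‖(↑u⁻¹ : X →L[ℂ] X)‖ + 1)⁻¹ (by positivity)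
  have hQQ : Q * Q = Q := hQ
  have hRQ : Commute R Q := hcomm R (Commute.refl R)
  have hTQ : Commute T Q := hcomm T hTR
  have huR : Commute (u : X →L[ℂ] X) (R * Q) := by
    rw [hu]
    exact (hTR.mul_right hTQ).sub_left ((Commute.one_left _).smul_left μ)
  have hunit : IsUnit (T - μ • (1 : X →L[ℂ] X) + R * Q) := by
    rw [← hu]
    refine huR.isUnit_add_of_spectrum_small (ε := (‖(↑u⁻¹ : X →L[ℂ] X)‖ + 1)⁻¹) (by positivity) ?_ hσ
    rw [inv_mul_le_iff₀ (by positivity)]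
    linarith
  have hcont : Continuous fun z : ℂ => T - z • (1 : X →L[ℂ] X) + R * Q := by fun_prop
  have hnhds := hcont.continuousAt.preimage_mem_nhds (Units.isOpen.mem_nhds hunit)
  have hred := Reduces.of_commute hQ (hTQ.add_left hRQ)
  have hfs : (spectrum ℂ ((T + R).restrict hred.invariant_left : Q.ker →L[ℂ] Q.ker)).Finite := by
    have := hred.isClosed_left.completeSpace_coe
    rw [ContinuousLinearMap.spectrum_eq]
    exact Module.End.finite_spectrum _
  refine ⟨_, hnhds, hfs.subset ?_⟩
  rintro z ⟨hzV, hz⟩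
  refine (hred.spectrum_subset hz).resolve_right ?_
  have hmem := algebraMap_sub_mem hred.invariant_right z
  have hzV' : IsUnit (T - z • (1 : X →L[ℂ] X) + R * Q) := hzV
  rw [spectrum.notMem_iff, algebraMap_sub_restrict _ z hmem]
  refine ContinuousLinearMap.isUnit_restrict_range hmem
    (U := -(T - z • (1 : X →L[ℂ] X) + R * Q)) hzV'.neg ?_ ?_
  · exact ((hTQ.sub_left ((Commute.one_left Q).smul_left z)).add_left
      (hRQ.mul_left (Commute.refl Q))).neg_left
  · rw [Algebra.algebraMap_eq_smul_one, neg_mul, add_mul (T - z • (1 : X →L[ℂ] X)), mul_assoc R, hQQ,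
      ← add_mul, ← neg_mul]
    congr 1
    abel

theorem HasFiniteCodimCuts.countable_spectrum_add_diff [CompleteSpace X] {T R : X →L[ℂ] X}
    (hR : HasFiniteCodimCuts R) (hTR : Commute T R) :
    (spectrum ℂ (T + R) \ spectrum ℂ T).Countable := by
  have h (μ : ℂ) : ∃ V : Set ℂ, μ ∉ spectrum ℂ T → V ∈ 𝓝 μ ∧ (V ∩ spectrum ℂ (T + R)).Finite := by
    by_cases hμ : μ ∈ spectrum ℂ T
    · exact ⟨∅, fun h => absurd hμ h⟩
    · obtain ⟨V, hV⟩ := hR.exists_nhds_finite_spectrum_add hTR hμ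
      exact ⟨V, fun _ => hV⟩
  choose V hV using h
  -- Lindelöf: countably many of these neighbourhoods cover the difference, each meeting the
  -- spectrum in a finite set.
  obtain ⟨t, hts, htc, hcover⟩ := TopologicalSpace.countable_cover_nhdsWithin (f := V)
    (s := spectrum ℂ (T + R) \ spectrum ℂ T) fun μ hμ => mem_nhdsWithin_of_mem_nhds (hV μ hμ.2).1
  refine (htc.biUnion fun μ hμ => (hV μ (hts hμ).2).2.countable).mono fun z hz => ?_
  obtain ⟨μ, hμ, hzμ⟩ := Set.mem_iUnion₂.1 (hcover hz)
  exact Set.mem_iUnion₂.2 ⟨μ, hμ, hzμ, hz.1⟩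

theorem HasFiniteCodimCuts.isAlmostInvertible_add [CompleteSpace X] {T R : X →L[ℂ] X}
    (hR : HasFiniteCodimCuts R) (hTR : Commute T R) (hT : IsAlmostInvertible T) :
    IsAlmostInvertible (T + R) := by
  rw [isAlmostInvertible_iff_countable] at hT ⊢
  obtain ⟨r, hr, hc⟩ := hT
  refine ⟨r, hr, (hc.union (hR.countable_spectrum_add_diff hTR)).mono ?_⟩
  rintro z ⟨hz, hzr⟩
  by_cases hzT : z ∈ spectrum ℂ T
  · exact Or.inl ⟨hzT, hzr⟩
  · exact Or.inr ⟨hz, hzT⟩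

theorem almostSpectrum_add_riesz [CompleteSpace X] {T R : X →L[ℂ] X} (hTR : Commute T R)
    (hR : IsRiesz R) : almostSpectrum (T + R) = almostSpectrum T := by
  ext z
  have hcuts := hR.hasFiniteCodimCuts
  have hcomm : Commute (T - z • (1 : X →L[ℂ] X)) R :=
    hTR.sub_left ((Commute.one_left R).smul_left z)
  have heq : T + R - z • (1 : X →L[ℂ] X) = T - z • (1 : X →L[ℂ] X) + R := by abel
  change ¬IsAlmostInvertible (T + R - z • (1 : X →L[ℂ] X)) ↔
    ¬IsAlmostInvertible (T - z • (1 : X →L[ℂ] X))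
  rw [heq, not_iff_not]
  refine ⟨fun h => ?_, hcuts.isAlmostInvertible_add hcomm⟩
  -- The converse undoes the perturbation by adding `-R`.
  have := hcuts.neg.isAlmostInvertible_add (hcomm.add_left (Commute.refl R)).neg_right h
  rwa [add_neg_cancel_right] at this

end Riesz

theorem mainTheorem8 {X : Type*} [NormedAddCommGroup X] [NormedSpace ℂ X] [CompleteSpace X]
    (T : X →L[ℂ] X) :
    (AlmostInv.IsAlmostInvertible T ↔ AlmostInv.IsAlmostInvertible (AlmostInv.dualOp T)) ∧
    (∀ (Y : Type*) [NormedAddCommGroup Y] [NormedSpace ℂ Y] [CompleteSpace Y] (S : Y →L[ℂ] Y),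
      AlmostInv.IsAlmostInvertible (T.prodMap S) ↔
        AlmostInv.IsAlmostInvertible T ∧ AlmostInv.IsAlmostInvertible S) ∧
    ((AlmostInv.IsAlmostInvertible T ↔
        ∃ m : ℕ, 1 ≤ m ∧ AlmostInv.IsAlmostInvertible (T ^ m)) ∧
      (AlmostInv.IsAlmostInvertible T ↔
        ∀ m : ℕ, 1 ≤ m → AlmostInv.IsAlmostInvertible (T ^ m))) ∧
    (∀ (M : Submodule ℂ X) [IsClosed (M : Set X)] (hM : ∀ x ∈ M, T x ∈ M),
      AlmostInv.IsAlmostInvertible (T.restrict hM : M →L[ℂ] M) →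
      AlmostInv.IsAlmostInvertible (AlmostInv.quotientOp T M hM) →
      AlmostInv.IsAlmostInvertible T) ∧
    (∀ R : X →L[ℂ] X, Commute T R → AlmostInv.IsRiesz R →
      AlmostInv.almostSpectrum (T + R) = AlmostInv.almostSpectrum T) := by
  refine ⟨(isAlmostInvertible_dualOp_iff T).symm, fun Y _ _ _ S => isAlmostInvertible_prodMap_iff T S,
    ⟨⟨fun h => ⟨1, le_rfl, by rwa [pow_one]⟩,
      fun ⟨m, hm, h⟩ => (isAlmostInvertible_pow_iff T hm).1 h⟩,
      ⟨fun h m hm => (isAlmostInvertible_pow_iff T hm).2 h,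
      fun h => (isAlmostInvertible_pow_iff T le_rfl).1 (h 1 le_rfl)⟩⟩,
    fun M _ hM => isAlmostInvertible_of_restrict_of_quotient M hM,
    fun R => almostSpectrum_add_riesz⟩
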